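/- **Proposition 1.1.** Let $p$ be a prime number, let $G$ be a pro-$p$ group, and let $\Delta$ be a finite group of order prime to $p$ acting on $G$ by continuous automorphisms. Let $\mathcal G = G\rtimes\Delta$ be the semidirect product, a profinite group for the product topology ($\Delta$ discrete). Let $G_\Delta$ be the maximal quotient of $G$ with trivial $\Delta$-action, i.e. the quotient of $G$ by the smallest closed normal subgroup containing all elements $g^{-1}\sigma(g)$ with $g\in G$, $\sigma\in\Delta$, and let $\mathcal G(p)$ be the maximal pro-$p$ quotient of $\mathcal G$, i.e. the quotient of $\mathcal G$ by the intersection of all its open normal subgroups of $p$-power index. Then the inclusion $G\hookrightarrow\mathcal G$ induces an isomorphism of topological groups $$G_\Delta \xrightarrow{\ \sim\ } \mathcal G(p).$$ Furthermore, if $H^2(G,\mathbb Z/p\mathbb Z)^\Delta=0$, where $H^2$ is continuous cohomology with trivial coefficients and $\Delta$ acts on it through its action on $G$, then $G_\Delta$ is a free pro-$p$ group (of possibly infinite rank): it is a pro-$p$ group having a family $(x_i)_{i\in I}$ converging to $1$ such that every family $(h_i)_{i\in I}$ converging to $1$ in a pro-$p$ group $H$ arises from a unique continuous homomorphism $G_\Delta\to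 H$ with $x_i\mapsto h_i$. (A family converges to $1$ if every neighbourhood of $1$ contains all but finitely many of its members.) -/

import Mathlib

open Topology CategoryTheory

universe u v w

/-! ### Pro-`p` groups and free pro-`p` groups -/

/-- A topological group is a pro-`p` group if it is profinite and every open normal subgroup
has index a power of `p`. -/
structure IsProP (p : ℕ) (G : Type*) [Group G] [TopologicalSpace G] [IsTopologicalGroup G] :
    Prop where
  compactSpace : CompactSpace G
  totallyDisconnectedSpace : TotallyDisconnectedSpace G
  index_eq_pow : ∀ U : Subgroup G, U.Normal → IsOpen (U : Set G) → ∃ k : ℕ, U.index = p ^ k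

/-- A family `f : X → G` converges to `1` if every neighbourhood of `1` contains `f x` for all but
finitely many `x`. -/
def ConvergesToOne {X G : Type*} [Group G] [TopologicalSpace G] (f : X → G) : Prop :=
  Filter.Tendsto f Filter.cofinite (𝓝 1)

/-- `F` is a free pro-`p` group (of arbitrary rank): it is a pro-`p` group which has a basis, i.e.
a family `ι : X → F` converging to `1` such that every family `X → H` converging to `1` in a pro-`p`
group `H` extends uniquely along `ι` to a continuous homomorphism `F → H`. -/
def IsFreeProP (p : ℕ) (F : Type u) [Group F] [TopologicalSpace F] [IsTopologicalGroup F] : Prop :=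
  IsProP p F ∧ ∃ (X : Type u) (ι : X → F), ConvergesToOne ι ∧
    ∀ (H : Type v) [Group H] [TopologicalSpace H] [IsTopologicalGroup H], IsProP p H →
      ∀ f : X → H, ConvergesToOne f → ∃! ψ : F →ₜ* H, ∀ x, ψ (ι x) = f x

/-! ### The maximal pro-`p` quotient -/

/-- The intersection of all open normal subgroups of `p`-power index. -/
def maxProPKer (p : ℕ) (G : Type*) [Group G] [TopologicalSpace G] : Subgroup G :=
  sInf {U : Subgroup G | U.Normal ∧ IsOpen (U : Set G) ∧ ∃ k : ℕ, U.index = p ^ k}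

instance maxProPKer_normal (p : ℕ) (G : Type*) [Group G] [TopologicalSpace G] :
    (maxProPKer p G).Normal :=
  ⟨fun n hn g => Subgroup.mem_sInf.2 fun U hU =>
    hU.1.conj_mem n (Subgroup.mem_sInf.1 hn U hU) g⟩

/-- The maximal pro-`p` quotient `G(p)` of a profinite group `G`. -/
abbrev MaxProPQuotient (p : ℕ) (G : Type*) [Group G] [TopologicalSpace G] : Type _ :=
  G ⧸ maxProPKer p G

/-! ### The maximal quotient with trivial action -/

/-- The smallest closed normal subgroup `N` of `G` such that `Δ` acts trivially on `G ⧸ N`, that is,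
`σ(g) ≡ g` modulo `N` for all `σ` and `g` (this implies that `N` is stable under `Δ`). -/
def maxTrivialKer {G Δ : Type*} [Group G] [TopologicalSpace G] [Group Δ] (φ : Δ →* MulAut G) :
    Subgroup G :=
  sInf {N : Subgroup G | N.Normal ∧ IsClosed (N : Set G) ∧ ∀ (σ : Δ) (g : G), g⁻¹ * φ σ g ∈ N}

/-- `maxTrivialKer φ` is itself normal, closed, and `Δ` acts trivially on the quotient by it; being
an intersection, it is the smallest such subgroup. -/
theorem maxTrivialKer_spec {G Δ : Type*} [Group G] [TopologicalSpace G] [Group Δ]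
    (φ : Δ →* MulAut G) :
    (maxTrivialKer φ).Normal ∧ IsClosed (maxTrivialKer φ : Set G) ∧
      ∀ (σ : Δ) (g : G), g⁻¹ * φ σ g ∈ maxTrivialKer φ := by
  refine ⟨⟨fun n hn g => Subgroup.mem_sInf.2 fun N hN =>
    hN.1.conj_mem n (Subgroup.mem_sInf.1 hn N hN) g⟩, ?_, fun σ g => ?_⟩
  · rw [maxTrivialKer, Subgroup.coe_sInf]
    exact isClosed_biInter fun N hN => hN.2.1
  · exact Subgroup.mem_sInf.2 fun N hN => hN.2.2 σ g

instance maxTrivialKer_normal {G Δ : Type*} [Group G] [TopologicalSpace G] [Group Δ]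
    (φ : Δ →* MulAut G) : (maxTrivialKer φ).Normal :=
  (maxTrivialKer_spec φ).1

/-- The maximal quotient `G_Δ` of `G` with trivial `Δ`-action. -/
abbrev MaxTrivialQuotient {G Δ : Type*} [Group G] [TopologicalSpace G] [Group Δ]
    (φ : Δ →* MulAut G) : Type _ :=
  G ⧸ maxTrivialKer φ

/-! ### Topology on the semidirect product -/

/-- The semidirect product carries the product topology of its underlying set `N × H`. -/
instance SemidirectProduct.instTopologicalSpace {N H : Type*} [Group N] [Group H]
    [TopologicalSpace N] [TopologicalSpace H] (φ : H →* MulAut N) :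
    TopologicalSpace (N ⋊[φ] H) :=
  TopologicalSpace.induced SemidirectProduct.equivProd inferInstance

/-! ### Continuous cohomology with trivial coefficients `ℤ/p`, with its `Δ`-action -/

instance ulift_zmod_continuousSMul (p : ℕ) : ContinuousSMul (ZMod p) (ULift.{u} (ZMod p)) :=
  ⟨continuous_of_discreteTopology⟩

/-- The trivial `G`-module `ℤ/p` (discrete), placed in the universe of `G`. -/
noncomputable abbrev trivialZMod (p : ℕ) (G : Type u) [Group G] : TopRep.{u} (ZMod p) G :=
  TopRep.of (ContRepresentation.trivial (ZMod p) G (ULift.{u} (ZMod p)))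

/-- The continuous cohomology group `Hⁿ(G, ℤ/p)`. -/
noncomputable abbrev cohomologyZMod (p n : ℕ) (G : Type u) [Group G] [TopologicalSpace G]
    [IsTopologicalGroup G] : TopModuleCat.{u} (ZMod p) :=
  continuousCohomology n (trivialZMod p G)

/-- The pullback `Hⁿ(G, ℤ/p) → Hⁿ(G', ℤ/p)` along a continuous homomorphism `α : G' → G`, with the
identity on coefficients. -/
noncomputable def cohomologyZModMap (p n : ℕ) {G G' : Type u} [Group G] [TopologicalSpace G]
    [IsTopologicalGroup G] [Group G'] [TopologicalSpace G'] [IsTopologicalGroup G']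
    (α : G' →ₜ* G) : cohomologyZMod p n G ⟶ cohomologyZMod p n G' :=
  ContinuousCohomology.map α
    (TopRep.ofHom (σ := ContRepresentation.trivial (ZMod p) G' (ULift.{u} (ZMod p)))
      { toContinuousLinearMap := ContinuousLinearMap.id (ZMod p) (ULift.{u} (ZMod p))
        isIntertwining' := fun _ => rfl }) n

/-- `x ∈ Hⁿ(G, ℤ/p)` is invariant under `Δ`, where `σ ∈ Δ` acts on `Hⁿ(G, ℤ/p)` by pullback along
the automorphism `σ⁻¹` of `G`. -/
def IsCohomologyInvariant (p n : ℕ) {G : Type u} {Δ : Type w} [Group G] [TopologicalSpace G]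
    [IsTopologicalGroup G] [Group Δ] (φ : Δ →* MulAut G) (hφ : ∀ σ, Continuous (φ σ))
    (x : cohomologyZMod p n G) : Prop :=
  ∀ σ : Δ, cohomologyZModMap p n (⟨(φ σ⁻¹).toMonoidHom, hφ σ⁻¹⟩ : G →ₜ* G) x = x

/-! The isomorphism rests on one fact: an element of order prime to `p` dies in every finite
`p`-quotient. Hence `Δ` dies in `𝒢(p)`, and so does each `g⁻¹σ(g)`, which in `𝒢` is a conjugate of
`σ` times `σ⁻¹`. Conversely `(g, σ) ↦ g` is a homomorphism from `𝒢` onto `G_Δ`, which is pro-`p`, so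
nothing more dies.

For freeness, the hypothesis is first turned into the vanishing of `H²(G_Δ, ℤ/p)`, in the cocycle
form `SplitsTwoCocycles`. A cocycle on `G_Δ` inflates to a `Δ`-invariant one on `G`, which is a
coboundary `df`. Averaging over `Δ`, whose order is invertible mod `p`, makes `f` invariant, and
minimality of the kernel of `G → G_Δ` then forces `f` to descend.

A pro-`p` group `P` whose 2-cocycles split is projective (`SplitsTwoCocycles.exists_section`): a
surjection `T → P` from a pro-`p` group is cut down to a minimal closed subgroup still surjecting,
and a nontrivial kernel there would yield a character of `T` whose kernel is smaller and still
surjects.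

Finally, a basis of the continuous characters of `P` has a dual family `x` tending to `1`
(`exists_dual_family`), which generates `P` topologically. For a family `f` in `H` tending to `1`,
the closed subgroup `T` of `P × H` generated by the pairs `(x j, f j)` has no characters beyond
those of `P`, so a section of `T → P` is onto. Thus `T` is the graph of the required homomorphism.
-/

/-! ### Cycles and homology classes of topological modules in terms of elements -/

namespace TopModuleCat

variable {k : Type u} [Ring k] [TopologicalSpace k] (K : CochainComplex (TopModuleCat.{v} k) ℕ)

theorem iCycles_injective (i : ℕ) : Function.Injective (K.iCycles i) := by
  have h := (K.cyclesIsKernel i _ rfl).conePointUniqueUpToIso_hom_comp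
    (isLimitKer (K.d i _)) Limits.WalkingParallelPair.zero
  intro z z' hz
  set e := (K.cyclesIsKernel i _ rfl).conePointUniqueUpToIso (isLimitKer (K.d i _))
  have h1 : ∀ z, kerι (K.d i _) (e.hom z) = K.iCycles i z := fun z => congr($h z)
  have h2 : e.hom z = e.hom z' := by
    apply Subtype.ext
    have := (h1 z).trans (hz.trans (h1 z').symm)
    exact this
  have h3 := congr(e.inv $h2)
  rwa [← ConcreteCategory.comp_apply, ← ConcreteCategory.comp_apply, e.hom_inv_id] at h3

theorem exists_iCycles_eq (i : ℕ) (x : K.X i) (hx : K.d i (i + 1) x = 0) :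
    ∃ z : K.cycles i, K.iCycles i z = x := by
  have hn : (ComplexShape.up ℕ).next i = i + 1 := by simp
  have h := (K.cyclesIsKernel i _ hn).conePointUniqueUpToIso_inv_comp
    (isLimitKer (K.d i _)) Limits.WalkingParallelPair.zero
  set e := (K.cyclesIsKernel i _ hn).conePointUniqueUpToIso (isLimitKer (K.d i (i + 1)))
  exact ⟨e.inv ⟨x, hx⟩, congr($h ⟨x, hx⟩)⟩

theorem exists_d_eq_of_homologyπ_eq_zero {i j : ℕ} (hij : i + 1 = j) (z : K.cycles j)
    (hz : K.homologyπ j z = 0) : ∃ y : K.X i, K.d i j y = K.iCycles j z := by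
  have hp : (ComplexShape.up ℕ).prev j = i := by simp [← hij]
  have h := (K.homologyIsCokernel i j hp).comp_coconePointUniqueUpToIso_hom
    (isColimitCoker (K.toCycles i j)) Limits.WalkingParallelPair.one
  set e := (K.homologyIsCokernel i j hp).coconePointUniqueUpToIso
    (isColimitCoker (K.toCycles i j))
  have h1 : cokerπ (K.toCycles i j) z = 0 := by
    have h2 : e.hom (K.homologyπ j z) = cokerπ (K.toCycles i j) z := congr($h z)
    rw [← h2, hz, map_zero]
  obtain ⟨y, hy⟩ : z ∈ (K.toCycles i j).hom.range := (Submodule.Quotient.mk_eq_zero _).1 h1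
  refine ⟨y, ?_⟩
  rw [← K.toCycles_i, ConcreteCategory.comp_apply]
  exact congr(K.iCycles j $hy)

end TopModuleCat

/-! ### From vanishing of invariant classes to inhomogeneous coboundaries -/

section Cohomology

variable {p : ℕ} {G : Type u} [Group G] [TopologicalSpace G] [IsTopologicalGroup G]

/-- The homogeneous `2`-cochain attached to an inhomogeneous continuous `2`-cochain. -/
def homogeneousOfInhomogeneous (c : G → G → ZMod p)
    (hc : Continuous (Function.uncurry c)) :
    C(G, C(G, C(G, ULift.{u} (ZMod p)))) :=
  ContinuousMap.curry (ContinuousMap.curry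
    ⟨fun x : (G × G) × G => ULift.up (c (x.1.1⁻¹ * x.1.2) (x.1.2⁻¹ * x.2)), by
      refine continuous_uliftUp.comp (hc.comp (f := fun x : (G × G) × G =>
        (x.1.1⁻¹ * x.1.2, x.1.2⁻¹ * x.2)) ?_)
      fun_prop⟩)

theorem homogeneousOfInhomogeneous_mem (c : G → G → ZMod p)
    (hc : Continuous (Function.uncurry c)) :
    homogeneousOfInhomogeneous c hc ∈
      (TopRep.resolutionX (trivialZMod p G) 3).ρ.invariants := by
  intro g
  refine ContinuousMap.ext fun x => ContinuousMap.ext fun y => ContinuousMap.ext fun z => ?_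
  change ULift.up (c ((g⁻¹ * x)⁻¹ * (g⁻¹ * y)) ((g⁻¹ * y)⁻¹ * (g⁻¹ * z))) =
    ULift.up (c (x⁻¹ * y) (y⁻¹ * z))
  congr 2 <;> group

/-- A continuous `2`-cocycle with values in the trivial module `ℤ/p`. -/
structure IsContTwoCocycle (c : G → G → ZMod p) : Prop where
  continuous : Continuous (Function.uncurry c)
  cocycle : ∀ x y z, c y z - c (x * y) z + c x (y * z) - c x y = 0

/-- The homogeneous form of an invariant cocycle is fixed by `Δ` already as a cochain, so its class
is invariant and therefore zero. -/
theorem IsContTwoCocycle.exists_eq_coboundary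
    {Δ : Type w} [Group Δ] (φ : Δ →* MulAut G) (hφ : ∀ σ, Continuous (φ σ))
    (hH : ∀ x : cohomologyZMod p 2 G, IsCohomologyInvariant p 2 φ hφ x → x = 0)
    {c : G → G → ZMod p} (hc : IsContTwoCocycle c)
    (hinv : ∀ σ x y, c (φ σ x) (φ σ y) = c x y) :
    ∃ f : G → ZMod p, Continuous f ∧ ∀ x y, c x y = f x + f y - f (x * y) := by
  let K := TopRep.homogeneousCochains (trivialZMod p G)
  let F : K.X 2 := ⟨homogeneousOfInhomogeneous c hc.continuous,
    homogeneousOfInhomogeneous_mem c hc.continuous⟩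
  have hF : K.d 2 3 F = 0 := by
    apply Subtype.ext
    refine (TopRep.homogeneousCochains.d_apply (trivialZMod p G) 2 F).trans ?_
    refine ContinuousMap.ext fun x => ContinuousMap.ext fun y => ContinuousMap.ext fun z =>
      ContinuousMap.ext fun t => ?_
    change ULift.up (c (y⁻¹ * z) (z⁻¹ * t)) - (ULift.up (c (x⁻¹ * z) (z⁻¹ * t)) -
      (ULift.up (c (x⁻¹ * y) (y⁻¹ * t)) - ULift.up (c (x⁻¹ * y) (y⁻¹ * z)))) = 0
    have h := hc.cocycle (x⁻¹ * y) (y⁻¹ * z) (z⁻¹ * t)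
    have h1 : x⁻¹ * y * (y⁻¹ * z) = x⁻¹ * z := by group
    have h2 : y⁻¹ * z * (z⁻¹ * t) = y⁻¹ * t := by group
    rw [h1, h2] at h
    apply ULift.ext
    change c (y⁻¹ * z) (z⁻¹ * t) - (c (x⁻¹ * z) (z⁻¹ * t) -
      (c (x⁻¹ * y) (y⁻¹ * t) - c (x⁻¹ * y) (y⁻¹ * z))) = 0
    rw [← h]; ring
  obtain ⟨z, hz⟩ := TopModuleCat.exists_iCycles_eq K 2 F hF
  have hzero : K.homologyπ 2 z = 0 := by
    apply hH
    intro σ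
    have h1 : ∀ (α : G →ₜ* G) (ψ : TopRep.res (α : G →* G) (trivialZMod p G) ⟶ trivialZMod p G),
        ContinuousCohomology.map α ψ 2 (K.homologyπ 2 z) =
          K.homologyπ 2 (ContinuousCohomology.cocyclesMap α ψ 2 z) := fun α ψ =>
      congr($(ContinuousCohomology.π_map α ψ 2) z)
    refine (h1 _ _).trans ?_
    congr 1
    apply TopModuleCat.iCycles_injective K 2
    rw [← ConcreteCategory.comp_apply, HomologicalComplex.cyclesMap_i,
      ConcreteCategory.comp_apply, hz]
    apply Subtype.ext
    refine ContinuousMap.ext fun x => ContinuousMap.ext fun y => ContinuousMap.ext fun t => ?_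
    change ULift.up (c ((φ σ⁻¹ x)⁻¹ * φ σ⁻¹ y) ((φ σ⁻¹ y)⁻¹ * φ σ⁻¹ t)) =
      ULift.up (c (x⁻¹ * y) (y⁻¹ * t))
    rw [← map_inv, ← map_inv, ← map_mul, ← map_mul, hinv]
  obtain ⟨Φ, hΦ⟩ := TopModuleCat.exists_d_eq_of_homologyπ_eq_zero K (i := 1) rfl z hzero
  rw [hz] at hΦ
  let Ψ : C(G, C(G, ULift.{u} (ZMod p))) := Φ.1
  have hΨ : ∀ g x y, Ψ (g⁻¹ * x) (g⁻¹ * y) = Ψ x y := fun g x y =>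
    congr((($(Φ.2 g) : C(G, C(G, ULift.{u} (ZMod p)))) x) y)
  have hd : ∀ x y t, Ψ y t - (Ψ x t - Ψ x y) = ULift.up (c (x⁻¹ * y) (y⁻¹ * t)) := by
    intro x y t
    have h := (TopRep.homogeneousCochains.d_apply (trivialZMod p G) 1 Φ).symm.trans
      congr(Subtype.val $hΦ)
    exact congr(((($h : C(G, C(G, C(G, ULift.{u} (ZMod p))))) x) y) t)
  -- A homogeneous 1-cochain is determined by its values at `(1, g)`; the coboundary identity at
  -- `(1, x, xy)` becomes the inhomogeneous one.
  refine ⟨fun g => (Ψ 1 g).down, continuous_uliftDown.comp (Ψ 1).continuous, fun x y => ?_⟩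
  have h := hd 1 x (x * y)
  have h2 := hΨ x x (x * y)
  rw [inv_mul_cancel, inv_mul_cancel_left] at h2
  rw [← h2, inv_one, one_mul, inv_mul_cancel_left] at h
  have h3 := congr(ULift.down $h)
  change (Ψ 1 y).down - ((Ψ 1 (x * y)).down - (Ψ 1 x).down) = c x y at h3
  rw [← h3]; ring

end Cohomology

/-- `H²(P, ℤ/p) = 0` in terms of inhomogeneous cocycles: every continuous `2`-cocycle with values
in the trivial module `ℤ/p` is a coboundary. -/
def SplitsTwoCocycles (p : ℕ) (P : Type*) [Group P] [TopologicalSpace P] : Prop :=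
  ∀ c : P → P → ZMod p, IsContTwoCocycle c →
    ∃ f : P → ZMod p, Continuous f ∧ ∀ x y, c x y = f x + f y - f (x * y)

/-! ### Descent of splittings to the quotient with trivial action -/

section Descent

variable {p : ℕ} [Fact p.Prime] {G : Type u} [Group G] [TopologicalSpace G]
  {Δ : Type w} [Group Δ] (φ : Δ →* MulAut G)

/-- Each translate of `f` by `Δ` has the same coboundary `c`, hence so does their mean, which exists
because the order of `Δ` is a unit mod `p`. -/
theorem exists_invariant_coboundary [Finite Δ] (hΔ : (Nat.card Δ).Coprime p)
    (hφ : ∀ σ, Continuous (φ σ)) {c : G → G → ZMod p}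
    (hinv : ∀ σ x y, c (φ σ x) (φ σ y) = c x y)
    {f : G → ZMod p} (hf : Continuous f) (hcf : ∀ x y, c x y = f x + f y - f (x * y)) :
    ∃ f' : G → ZMod p, Continuous f' ∧ (∀ x y, c x y = f' x + f' y - f' (x * y)) ∧
      ∀ σ x, f' (φ σ x) = f' x := by
  have := Fintype.ofFinite Δ
  have hunit : (Nat.card Δ : ZMod p) ≠ 0 := by
    intro h
    rw [ZMod.natCast_eq_zero_iff] at h
    exact (Fact.out : p.Prime).one_lt.ne' (Nat.Coprime.eq_one_of_dvd hΔ.symm h)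
  refine ⟨fun x => (Nat.card Δ : ZMod p)⁻¹ * ∑ σ, f (φ σ x), ?_, fun x y => ?_, fun τ x => ?_⟩
  · exact continuous_const.mul (continuous_finsetSum _ fun σ _ => hf.comp (hφ σ))
  · beta_reduce
    rw [← mul_add, ← mul_sub, ← Finset.sum_add_distrib, ← Finset.sum_sub_distrib]
    have : ∀ σ, f (φ σ x) + f (φ σ y) - f (φ σ (x * y)) = c x y := fun σ => by
      rw [map_mul, ← hcf, hinv]
    simp_rw [this]
    rw [Finset.sum_const, Finset.card_univ, ← Nat.card_eq_fintype_card, nsmul_eq_mul,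
      inv_mul_cancel_left₀ hunit]
  · have h : ∑ σ, f (φ σ (φ τ x)) = ∑ σ, f (φ σ x) :=
      Fintype.sum_equiv (Equiv.mulRight τ) _ _ fun σ => by simp
    exact congrArg _ h

/-- The inflated cocycle is constant when one argument lies in the kernel of `G → G_Δ`, so there the
invariant primitive `f` is a homomorphism up to the constant `c 1 1`. It remains to see that this
homomorphism is zero. -/
theorem splitsTwoCocycles_maxTrivialQuotient [IsTopologicalGroup G] [Finite Δ] (hΔ : (Nat.card Δ).Coprime p)
    (hφ : ∀ σ, Continuous (φ σ))
    (hH : ∀ x : cohomologyZMod p 2 G, IsCohomologyInvariant p 2 φ hφ x → x = 0) :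
    SplitsTwoCocycles p (MaxTrivialQuotient φ) := by
  intro c hc
  have hφq : ∀ σ g, (QuotientGroup.mk (φ σ g) : MaxTrivialQuotient φ) = QuotientGroup.mk g :=
    fun σ g => (QuotientGroup.eq.2 ((maxTrivialKer_spec φ).2.2 σ g)).symm
  let c' : G → G → ZMod p := fun x y => c (QuotientGroup.mk x) (QuotientGroup.mk y)
  have hc' : IsContTwoCocycle c' :=
    ⟨hc.continuous.comp (f := fun x : G × G => ((QuotientGroup.mk x.1 : MaxTrivialQuotient φ),
        (QuotientGroup.mk x.2 : MaxTrivialQuotient φ)))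
      ((continuous_quotient_mk'.comp continuous_fst).prodMk
        (continuous_quotient_mk'.comp continuous_snd)),
      fun x y z => hc.cocycle (QuotientGroup.mk x) (QuotientGroup.mk y) (QuotientGroup.mk z)⟩
  have hinv : ∀ σ x y, c' (φ σ x) (φ σ y) = c' x y := fun σ x y => by
    simp only [c', hφq]
  obtain ⟨f₀, hf₀, hcf₀⟩ := hc'.exists_eq_coboundary φ hφ hH hinv
  obtain ⟨f, hf, hcf, hfinv⟩ := exists_invariant_coboundary φ hΔ hφ hinv hf₀ hcf₀
  have hone : ∀ x, c 1 x = c 1 1 := fun x => by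
    have := hc.cocycle 1 1 x
    simp only [one_mul] at this
    linear_combination this
  have hone' : ∀ x, c x 1 = c 1 1 := fun x => by
    have := hc.cocycle x 1 1
    simp only [mul_one] at this
    linear_combination -this
  have hleft : ∀ n ∈ maxTrivialKer φ, ∀ x, f (n * x) = f n + f x - c 1 1 := fun n hn x => by
    have h := hcf n x
    simp only [c'] at h
    rw [(QuotientGroup.eq_one_iff n).2 hn, hone] at h
    linear_combination h
  have hright : ∀ n ∈ maxTrivialKer φ, ∀ x, f (x * n) = f x + f n - c 1 1 := fun n hn x => by
    have h := hcf x n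
    simp only [c'] at h
    rw [(QuotientGroup.eq_one_iff n).2 hn, hone'] at h
    linear_combination h
  -- The part of the kernel on which `f - c 1 1` vanishes. It is closed and normal, and it contains
  -- each `g⁻¹σ(g)` because `f` is `Δ`-invariant; by minimality it is the whole kernel.
  let N : Subgroup G :=
    { carrier := {n | n ∈ maxTrivialKer φ ∧ f n = c 1 1}
      one_mem' := ⟨one_mem _, by
        have := hcf 1 1
        simp only [c', QuotientGroup.mk_one, mul_one] at this
        linear_combination -this⟩
      mul_mem' := fun {a b} ha hb => ⟨mul_mem ha.1 hb.1, by
        rw [hleft a ha.1, ha.2, hb.2]; ring⟩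
      inv_mem' := fun {a} ha => ⟨inv_mem ha.1, by
        have h := hleft a ha.1 a⁻¹
        have h1 := hcf 1 1
        simp only [c', QuotientGroup.mk_one, mul_one] at h1
        rw [mul_inv_cancel, ha.2] at h
        linear_combination -h - h1⟩ }
  have hN : maxTrivialKer φ ≤ N := by
    refine sInf_le ⟨⟨fun n hn g => ⟨Subgroup.Normal.conj_mem inferInstance n hn.1 g, ?_⟩⟩, ?_,
      fun σ g => ⟨(maxTrivialKer_spec φ).2.2 σ g, ?_⟩⟩
    · have h1 := hleft (g * n * g⁻¹) (Subgroup.Normal.conj_mem inferInstance n hn.1 g) g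
      have h2 := hright n hn.1 g
      rw [inv_mul_cancel_right] at h1
      linear_combination h2 - h1 + hn.2
    · exact (maxTrivialKer_spec φ).2.1.inter (isClosed_singleton.preimage hf)
    · have h := hright _ ((maxTrivialKer_spec φ).2.2 σ g) g
      rw [mul_inv_cancel_left, hfinv] at h
      linear_combination -h
  have hfN : ∀ a b : G, (QuotientGroup.leftRel (maxTrivialKer φ)) a b → f a = f b := by
    intro a b hab
    have hab := QuotientGroup.leftRel_apply.1 hab
    have h := hright _ hab a
    rw [mul_inv_cancel_left, (hN hab).2] at h
    linear_combination -h
  refine ⟨Quotient.lift f hfN, hf.quotient_lift hfN, fun x y => ?_⟩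
  induction x using QuotientGroup.induction_on with | H x => ?_
  induction y using QuotientGroup.induction_on with | H y => ?_
  exact hcf x y

end Descent

/-! ### Characters of order `p` of finite `p`-groups -/

section FiniteGroup

variable {p : ℕ} [Fact p.Prime] {Q : Type*} [Group Q] [Finite Q]

theorem Subgroup.card_eq_prime_of_isCoatom_bot (hQ : IsPGroup p Q) (h : IsCoatom (⊥ : Subgroup Q)) :
    Nat.card Q = p := by
  have : Nontrivial Q := by
    by_contra hc
    rw [not_nontrivial_iff_subsingleton] at hc
    exact h.1 (Subsingleton.elim _ _)
  have hdvd : p ∣ Nat.card Q := by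
    obtain ⟨n, hn, h⟩ := hQ.nontrivial_iff_card.1 this
    rw [h]; exact dvd_pow_self p hn.ne'
  obtain ⟨z, hz⟩ := exists_prime_orderOf_dvd_card' p hdvd
  have htop : Subgroup.zpowers z = ⊤ := by
    apply h.2
    rw [bot_lt_iff_ne_bot, Ne, Subgroup.zpowers_eq_bot]
    rintro rfl
    rw [orderOf_one] at hz
    exact (Fact.out : p.Prime).one_lt.ne hz
  rw [← hz, ← Nat.card_zpowers, htop, Subgroup.card_top]

/-- A proper subgroup of a finite `p`-group lies in the kernel of a nontrivial character of
order `p`. -/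
theorem IsPGroup.exists_hom_zmod_ne_one (hQ : IsPGroup p Q) {D : Subgroup Q} (hD : D ≠ ⊤) :
    ∃ χ : Q →* Multiplicative (ZMod p), D ≤ χ.ker ∧ χ ≠ 1 := by
  obtain ⟨L, hL, hDL⟩ := (eq_top_or_exists_le_coatom D).resolve_left hD
  have hnil : Group.IsNilpotent Q := hQ.isNilpotent
  have hLn : L.Normal := Subgroup.NormalizerCondition.normal_of_coatom L Group.normalizerCondition_of_isNilpotent hL
  have hbot : IsCoatom (⊥ : Subgroup (Q ⧸ L)) := by
    refine ⟨fun h => hL.1 ?_, fun M hM => ?_⟩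
    · have h1 := congrArg (Subgroup.comap (QuotientGroup.mk' L)) h
      rwa [MonoidHom.comap_bot, QuotientGroup.ker_mk', Subgroup.comap_top] at h1
    · have h1 : L < M.comap (QuotientGroup.mk' L) := by
        have := (Subgroup.comap_lt_comap_of_surjective (QuotientGroup.mk'_surjective L)).2 hM
        rwa [MonoidHom.comap_bot, QuotientGroup.ker_mk'] at this
      have h2 := hL.2 _ h1
      rw [← Subgroup.map_comap_eq_self_of_surjective (QuotientGroup.mk'_surjective L) M, h2,
        Subgroup.map_top_of_surjective _ (QuotientGroup.mk'_surjective L)]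
  have hcard := Subgroup.card_eq_prime_of_isCoatom_bot (hQ.to_quotient L) hbot
  have e : Q ⧸ L ≃* Multiplicative (ZMod p) :=
    mulEquivOfPrimeCardEq hcard (by simp)
  have hker : (e.toMonoidHom.comp (QuotientGroup.mk' L)).ker = L := by
    ext x; simp
  refine ⟨e.toMonoidHom.comp (QuotientGroup.mk' L), hker.symm ▸ hDL, fun h => hL.1 ?_⟩
  rw [← hker, h, MonoidHom.ker_one]

/-- A nontrivial normal subgroup of a finite `p`-group has a nontrivial invariant character of
order `p`. -/
theorem IsPGroup.exists_invariant_hom_zmod (hQ : IsPGroup p Q) (N : Subgroup Q) [N.Normal]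
    (hN : N ≠ ⊥) : ∃ χ : N →* Multiplicative (ZMod p), χ ≠ 1 ∧
      ∀ (q : Q) (n : N), χ (MulAut.conjNormal q n) = χ n := by
  have hbot : (⊥ : Subgroup N) ≠ ⊤ := by
    intro h
    apply hN
    rw [eq_bot_iff]
    intro x hx
    have : (⟨x, hx⟩ : N) ∈ (⊥ : Subgroup N) := h ▸ Subgroup.mem_top _
    simpa using this
  obtain ⟨χ₀, -, hχ₀⟩ := (hQ.to_subgroup N).exists_hom_zmod_ne_one hbot
  have : Finite (N →* Multiplicative (ZMod p)) :=
    Finite.of_injective (fun χ => (χ : N → Multiplicative (ZMod p))) DFunLike.coe_injective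
  let _ : MulAction Q (N →* Multiplicative (ZMod p)) :=
    { smul := fun q χ => χ.comp (MulAut.conjNormal q⁻¹).toMonoidHom
      one_smul := fun χ => by
        ext n
        change χ (MulAut.conjNormal (1 : Q)⁻¹ n) = χ n
        simp
      mul_smul := fun a b χ => by
        ext n
        change χ (MulAut.conjNormal (a * b)⁻¹ n) =
          χ (MulAut.conjNormal b⁻¹ (MulAut.conjNormal a⁻¹ n))
        rw [mul_inv_rev, map_mul]; rfl }
  have hdvd : p ∣ Nat.card (N →* Multiplicative (ZMod p)) := by
    have h : orderOf χ₀ = p := by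
      refine orderOf_eq_prime ?_ hχ₀
      ext n
      simp only [MonoidHom.pow_apply, MonoidHom.one_apply, ← ofAdd_zero]
      rw [← ofAdd_toAdd (χ₀ n), ← ofAdd_nsmul]
      simp
    have h' := orderOf_dvd_natCard χ₀
    rwa [h] at h'
  -- The number of fixed points of a `p`-group on a set of order divisible by `p` is divisible by
  -- `p`. The trivial character is one, so there is another.
  obtain ⟨χ, hχ, hne⟩ := hQ.exists_fixed_point_of_prime_dvd_card_of_fixed_point _ hdvd
    (a := 1) (fun q => rfl)
  refine ⟨χ, hne.symm, fun q n => ?_⟩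
  have := congr($(hχ q⁻¹) n)
  change χ (MulAut.conjNormal q⁻¹⁻¹ n) = χ n at this
  rwa [inv_inv] at this

/-- A nontrivial invariant character of `N` extends to a function on the whole group that is
additive with respect to multiplication by `N`. -/
theorem IsPGroup.exists_partially_additive (hQ : IsPGroup p Q) (N : Subgroup Q) [N.Normal]
    (hN : N ≠ ⊥) : ∃ θ : Q → ZMod p, (∃ n ∈ N, θ n ≠ 0) ∧
      ∀ n ∈ N, ∀ q, θ (n * q) = θ n + θ q ∧ θ (q * n) = θ q + θ n := by
  obtain ⟨χ, hχ, hinv⟩ := hQ.exists_invariant_hom_zmod N hN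
  have hmem : ∀ q : Q, q * (QuotientGroup.mk q : Q ⧸ N).out⁻¹ ∈ N := fun q => by
    rw [← QuotientGroup.eq_one_iff, QuotientGroup.mk_mul, QuotientGroup.mk_inv,
      QuotientGroup.out_eq', mul_inv_cancel]
  -- The `N`-component of `q` relative to a transversal. Dividing by `ρ 1` below corrects for a
  -- representative of the trivial coset other than `1`, so that `θ` restricts to `χ` on `N`.
  let ρ : Q → N := fun q => ⟨_, hmem q⟩
  have hρ : ∀ (n : N) (q : Q), ρ (n * q) = n * ρ q := fun n q => by
    apply Subtype.ext
    have : (QuotientGroup.mk (n * q : Q) : Q ⧸ N) = QuotientGroup.mk q := by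
      rw [QuotientGroup.mk_mul, (QuotientGroup.eq_one_iff (n : Q)).2 n.2, one_mul]
    simp only [ρ, Subgroup.coe_mul]
    rw [this, mul_assoc]
  let θ : Q → ZMod p := fun q => (χ (ρ q * (ρ 1)⁻¹)).toAdd
  have hθN : ∀ n : N, θ n = (χ n).toAdd := fun n => by
    have := hρ n 1
    rw [mul_one] at this
    simp only [θ]
    rw [this, mul_inv_cancel_right]
  have hleft : ∀ (n : N) (q : Q), θ (n * q) = θ n + θ q := fun n q => by
    rw [hθN]
    simp only [θ]
    rw [hρ, mul_assoc, map_mul, toAdd_mul]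
  refine ⟨θ, ?_, fun n hn q => ⟨hleft ⟨n, hn⟩ q, ?_⟩⟩
  · obtain ⟨n, hn⟩ : ∃ n, χ n ≠ 1 := by
      by_contra! h
      exact hχ (MonoidHom.ext h)
    exact ⟨n, n.2, fun h => hn (by rw [hθN] at h; exact h)⟩
  -- Right additivity follows from left additivity by moving `n` across `q`; this is where
  -- invariance of `χ` under conjugation is used.
  · have h : q * n = (MulAut.conjNormal q (⟨n, hn⟩ : N) : N) * q := by
      rw [MulAut.conjNormal_apply, inv_mul_cancel_right]
    rw [h, hleft, hθN, hinv, ← hθN, add_comm]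

end FiniteGroup

/-! ### Permanence properties of pro-`p` groups -/

section ProP

variable {p : ℕ}

namespace Subgroup

variable {T S : Type*} [Group T] [Group S]

theorem isPGroup_quotient {U : Subgroup T} [U.Normal] (hU : ∃ k : ℕ, U.index = p ^ k) :
    IsPGroup p (T ⧸ U) :=
  let ⟨_, hk⟩ := hU
  IsPGroup.of_card hk

variable [Fact p.Prime]

theorem exists_pow_of_dvd_index {m : ℕ} {U : Subgroup T} (hU : ∃ k : ℕ, U.index = p ^ k)
    (h : m ∣ U.index) : ∃ k : ℕ, m = p ^ k := by
  obtain ⟨k, hk⟩ := hU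
  obtain ⟨j, -, hj⟩ := (Nat.dvd_prime_pow (Fact.out : p.Prime)).1 (hk ▸ h)
  exact ⟨j, hj⟩

theorem index_inf_eq_pow {U V : Subgroup T} [U.Normal] (hU : ∃ k : ℕ, U.index = p ^ k)
    (hV : ∃ k : ℕ, V.index = p ^ k) : ∃ k : ℕ, (U ⊓ V).index = p ^ k := by
  obtain ⟨j, hj⟩ := exists_pow_of_dvd_index hU (relIndex_dvd_index_of_normal U V)
  obtain ⟨i, hi⟩ := hV
  refine ⟨j + i, ?_⟩
  rw [← relIndex_mul_index (inf_le_right : U ⊓ V ≤ V), inf_relIndex_right, hj, hi, pow_add]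

theorem index_comap_eq_pow (f : S →* T) {U : Subgroup T} [U.Normal]
    (hU : ∃ k : ℕ, U.index = p ^ k) : ∃ k : ℕ, (U.comap f).index = p ^ k := by
  rw [index_comap]
  exact exists_pow_of_dvd_index hU (relIndex_dvd_index_of_normal U _)

end Subgroup

namespace IsProP

variable {T : Type*} [Group T] [TopologicalSpace T] [IsTopologicalGroup T]

theorem t2Space (hT : IsProP p T) : T2Space T := by
  have := hT.totallyDisconnectedSpace
  infer_instance

theorem exists_openNormal_disjoint (hT : IsProP p T) {C : Set T} (hC : IsClosed C)
    (h1 : 1 ∉ C) : ∃ U : Subgroup T, U.Normal ∧ IsOpen (U : Set T) ∧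
      (∃ k : ℕ, U.index = p ^ k) ∧ Disjoint (U : Set T) C := by
  have := hT.compactSpace
  have := hT.totallyDisconnectedSpace
  obtain ⟨U, hU⟩ := ProfiniteGrp.exist_openNormalSubgroup_sub_open_nhds_of_one hC.isOpen_compl h1
  exact ⟨U.toSubgroup, inferInstance, U.isOpen, hT.index_eq_pow _ inferInstance U.isOpen,
    Set.subset_compl_iff_disjoint_right.1 hU⟩

variable [Fact p.Prime]

/-- A compact group whose open normal subgroups of `p`-power index separate points is pro-`p`. -/
theorem of_separating [CompactSpace T]
    (h : ∀ t : T, t ≠ 1 → ∃ W : Subgroup T, W.Normal ∧ IsOpen (W : Set T) ∧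
      (∃ k : ℕ, W.index = p ^ k) ∧ t ∉ W) : IsProP p T where
  compactSpace := inferInstance
  totallyDisconnectedSpace := by
    have : TotallySeparatedSpace T := by
      refine totallySeparatedSpace_iff_exists_isClopen.2 fun x y hxy => ?_
      obtain ⟨W, -, hWo, -, hW⟩ := h (x⁻¹ * y) (by rwa [Ne, inv_mul_eq_one])
      refine ⟨(fun z => x⁻¹ * z) ⁻¹' W, ⟨?_, ?_⟩, ?_, hW⟩
      · exact (Subgroup.isClosed_of_isOpen W hWo).preimage (continuous_const_mul _)
      · exact hWo.preimage (continuous_const_mul _)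
      · simp
    infer_instance
  index_eq_pow U _ hUo := by
    let I := {W : Subgroup T // W.Normal ∧ IsOpen (W : Set T) ∧ ∃ k : ℕ, W.index = p ^ k}
    have : Nonempty I := ⟨⟨⊤, inferInstance, isOpen_univ, 0, by simp⟩⟩
    -- The subgroups `W` form a directed family with trivial intersection, so by compactness one of
    -- them lies in `U`, and the index of `U` divides that of `W`.
    obtain ⟨W, hW⟩ := hUo.isClosed_compl.isCompact.elim_directed_family_closed
      (fun W : I => (W.1 : Set T)) (fun W => Subgroup.isClosed_of_isOpen W.1 W.2.2.1) (by
        rw [← Set.disjoint_iff_inter_eq_empty, Set.disjoint_compl_left_iff_subset]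
        intro t ht
        by_cases ht1 : t = 1
        · exact ht1 ▸ one_mem U
        · obtain ⟨W, hWn, hWo, hWk, hW⟩ := h t ht1
          exact absurd (Set.mem_iInter.1 ht ⟨W, hWn, hWo, hWk⟩) hW)
      (fun W W' => by
        have := W.2.1
        have := W'.2.1
        exact ⟨⟨W.1 ⊓ W'.1, inferInstance, W.2.2.1.inter W'.2.2.1,
          Subgroup.index_inf_eq_pow W.2.2.2 W'.2.2.2⟩, fun _ hx => hx.1, fun _ hx => hx.2⟩)
    rw [← Set.disjoint_iff_inter_eq_empty, Set.disjoint_compl_left_iff_subset] at hW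
    exact Subgroup.exists_pow_of_dvd_index W.2.2.2 (Subgroup.index_dvd_of_le hW)

theorem subgroup (hT : IsProP p T) (S : Subgroup T) (hS : IsClosed (S : Set T)) :
    IsProP p S := by
  have := hT.compactSpace
  have := hT.t2Space
  have : CompactSpace S := isCompact_iff_compactSpace.1 hS.isCompact
  refine of_separating fun s hs => ?_
  obtain ⟨U, hUn, hUo, hUk, hU⟩ := hT.exists_openNormal_disjoint
    (isClosed_singleton (x := (s : T))) (fun h => hs (Subtype.ext h.symm))
  exact ⟨U.comap S.subtype, inferInstance, hUo.preimage continuous_subtype_val,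
    Subgroup.index_comap_eq_pow _ hUk, fun h => Set.disjoint_left.1 hU h rfl⟩

theorem prod {S : Type*} [Group S] [TopologicalSpace S] [IsTopologicalGroup S]
    (hT : IsProP p T) (hS : IsProP p S) : IsProP p (T × S) := by
  have := hT.compactSpace
  have := hS.compactSpace
  have := hT.t2Space
  have := hS.t2Space
  refine of_separating fun s hs => ?_
  by_cases h1 : s.1 = 1
  · have h2 : s.2 ≠ 1 := fun h2 => hs (Prod.ext h1 h2)
    obtain ⟨U, hUn, hUo, hUk, hU⟩ := hS.exists_openNormal_disjoint
      (isClosed_singleton (x := s.2)) (fun h => h2 h.symm)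
    exact ⟨U.comap (MonoidHom.snd T S), inferInstance, hUo.preimage continuous_snd,
      Subgroup.index_comap_eq_pow _ hUk, fun h => Set.disjoint_left.1 hU h rfl⟩
  · obtain ⟨U, hUn, hUo, hUk, hU⟩ := hT.exists_openNormal_disjoint
      (isClosed_singleton (x := s.1)) (fun h => h1 h.symm)
    exact ⟨U.comap (MonoidHom.fst T S), inferInstance, hUo.preimage continuous_fst,
      Subgroup.index_comap_eq_pow _ hUk, fun h => Set.disjoint_left.1 hU h rfl⟩

theorem quotient (hT : IsProP p T) (N : Subgroup T) [N.Normal] (hN : IsClosed (N : Set T)) :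
    IsProP p (T ⧸ N) := by
  have := hT.compactSpace
  refine of_separating fun s hs => ?_
  induction s using QuotientGroup.induction_on with | H s => ?_
  obtain ⟨U, hUn, hUo, hUk, hU⟩ := hT.exists_openNormal_disjoint
    (hN.preimage (continuous_const_mul s)) (fun h => hs (by
      rw [QuotientGroup.eq_one_iff]; simpa using h))
  refine ⟨U.map (QuotientGroup.mk' N), hUn.map _ (QuotientGroup.mk'_surjective N),
    QuotientGroup.isOpenMap_coe _ hUo, ?_, ?_⟩
  · exact Subgroup.exists_pow_of_dvd_index hUk
      (U.index_map_dvd (QuotientGroup.mk'_surjective N))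
  · rintro ⟨u, hu, hus⟩
    have h : u⁻¹ * s ∈ N := QuotientGroup.eq.1 hus
    refine Set.disjoint_left.1 hU (inv_mem hu) ?_
    have := Subgroup.Normal.conj_mem inferInstance _ h u
    rw [mul_inv_cancel_left] at this
    exact this

end IsProP

end ProP

/-! ### Continuous characters with values in `ℤ/p` -/

section Characters

/-- The space of continuous homomorphisms from `T` to `ℤ/p`. -/
def contHomZMod (p : ℕ) (T : Type*) [Group T] [TopologicalSpace T] :
    Submodule (ZMod p) (T → ZMod p) where
  carrier := {f | Continuous f ∧ ∀ x y, f (x * y) = f x + f y}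
  add_mem' := fun {f g} hf hg => ⟨hf.1.add hg.1, fun x y => by
    simp only [Pi.add_apply, hf.2, hg.2]; ring⟩
  zero_mem' := ⟨continuous_const, fun _ _ => by simp⟩
  smul_mem' := fun c f hf => ⟨continuous_const.mul hf.1, fun x y => by
    simp only [Pi.smul_apply, hf.2, smul_eq_mul]; ring⟩

namespace contHomZMod

variable {p : ℕ} {T S : Type*} [Group T] [TopologicalSpace T] [Group S] [TopologicalSpace S]

theorem apply_mul {f : T → ZMod p} (hf : f ∈ contHomZMod p T) (x y : T) :
    f (x * y) = f x + f y := hf.2 x y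

theorem apply_one {f : T → ZMod p} (hf : f ∈ contHomZMod p T) : f 1 = 0 := by
  have := hf.2 1 1
  rw [mul_one] at this
  linear_combination -this

theorem apply_inv {f : T → ZMod p} (hf : f ∈ contHomZMod p T) (x : T) : f x⁻¹ = -f x := by
  have := hf.2 x x⁻¹
  rw [mul_inv_cancel, apply_one hf] at this
  linear_combination -this

theorem comp_mem {f : T → ZMod p} (hf : f ∈ contHomZMod p T) (α : S →* T) (hα : Continuous α) :
    f ∘ α ∈ contHomZMod p S :=
  ⟨hf.1.comp hα, fun x y => by simp [hf.2]⟩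

theorem apply_pow {f : T → ZMod p} (hf : f ∈ contHomZMod p T) (x : T) (m : ℕ) :
    f (x ^ m) = m * f x := by
  induction m with
  | zero => simp [apply_one hf]
  | succ m ih => rw [pow_succ, hf.2, ih]; push_cast; ring

/-- The kernel of a continuous character. -/
def ker {f : T → ZMod p} (hf : f ∈ contHomZMod p T) : Subgroup T where
  carrier := {t | f t = 0}
  mul_mem' := fun {a b} (ha : f a = 0) (hb : f b = 0) => by
    change f (a * b) = 0
    rw [hf.2, ha, hb, add_zero]
  one_mem' := apply_one hf
  inv_mem' := fun {a} (ha : f a = 0) => by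
    change f a⁻¹ = 0
    rw [apply_inv hf, ha, neg_zero]

theorem mem_ker {f : T → ZMod p} (hf : f ∈ contHomZMod p T) (t : T) : t ∈ ker hf ↔ f t = 0 :=
  Iff.rfl

theorem isClosed_ker {f : T → ZMod p} (hf : f ∈ contHomZMod p T) :
    IsClosed (ker hf : Set T) :=
  isClosed_singleton.preimage hf.1

end contHomZMod

namespace IsProP

variable {p : ℕ} [Fact p.Prime] {T : Type*} [Group T] [TopologicalSpace T] [IsTopologicalGroup T]

/-- In a pro-`p` group a proper closed subgroup is contained in the kernel of a nonzero continuous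
homomorphism to `ℤ/p`. -/
theorem exists_contHomZMod_ne_zero (hT : IsProP p T) {D : Subgroup T} (hD : IsClosed (D : Set T))
    (hne : D ≠ ⊤) : ∃ χ ∈ contHomZMod p T, χ ≠ 0 ∧ ∀ d ∈ D, χ d = 0 := by
  have := hT.compactSpace
  obtain ⟨t, ht⟩ : ∃ t, t ∉ D := by
    by_contra! h
    exact hne (eq_top_iff.2 fun x _ => h x)
  obtain ⟨U, hUn, hUo, hUk, hU⟩ := hT.exists_openNormal_disjoint
    (hD.preimage (continuous_const_mul t)) (by simpa using ht)
  have : Finite (T ⧸ U) := Subgroup.quotient_finite_of_isOpen U hUo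
  have : DiscreteTopology (T ⧸ U) := QuotientGroup.discreteTopology hUo
  have hD' : D.map (QuotientGroup.mk' U) ≠ ⊤ := by
    intro h
    obtain ⟨d, hd, hdt⟩ : QuotientGroup.mk' U t ∈ D.map (QuotientGroup.mk' U) :=
      h ▸ Subgroup.mem_top _
    have h1 : t⁻¹ * d ∈ U := QuotientGroup.eq.1 hdt.symm
    refine Set.disjoint_left.1 hU h1 ?_
    simpa using hd
  obtain ⟨χ, hχD, hχ⟩ := (Subgroup.isPGroup_quotient hUk).exists_hom_zmod_ne_one hD'
  refine ⟨fun t => (χ (QuotientGroup.mk t)).toAdd, ⟨?_, fun x y => ?_⟩, fun h => hχ ?_,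
    fun d hd => ?_⟩
  · exact (continuous_of_discreteTopology (f := fun q => (χ q).toAdd)).comp
      continuous_quotient_mk'
  · beta_reduce
    rw [QuotientGroup.mk_mul, map_mul, toAdd_mul]
  · ext q
    exact congrFun h q
  · have : (QuotientGroup.mk d : T ⧸ U) ∈ χ.ker := hχD ⟨d, hd, rfl⟩
    rw [MonoidHom.mem_ker] at this
    beta_reduce
    rw [this, toAdd_one]

/-- For a nontrivial closed normal subgroup `K` of a pro-`p` group, there is a continuous function
to `ℤ/p`, nonzero on `K`, which is additive with respect to multiplication by `K`. -/
theorem exists_partially_additive (hT : IsProP p T) {K : Subgroup T} [K.Normal] (hne : K ≠ ⊥) :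
    ∃ θ : T → ZMod p, Continuous θ ∧ (∃ n ∈ K, θ n ≠ 0) ∧
      ∀ n ∈ K, ∀ q, θ (n * q) = θ n + θ q ∧ θ (q * n) = θ q + θ n := by
  have := hT.compactSpace
  have := hT.t2Space
  obtain ⟨t, htK, ht⟩ := K.bot_or_exists_ne_one.resolve_left hne
  obtain ⟨U, hUn, hUo, hUk, hU⟩ := hT.exists_openNormal_disjoint
    (isClosed_singleton (x := t)) (fun h => ht h.symm)
  have : Finite (T ⧸ U) := Subgroup.quotient_finite_of_isOpen U hUo
  have : DiscreteTopology (T ⧸ U) := QuotientGroup.discreteTopology hUo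
  have hN : (K.map (QuotientGroup.mk' U)).Normal :=
    Subgroup.Normal.map inferInstance _ (QuotientGroup.mk'_surjective U)
  have hNbot : K.map (QuotientGroup.mk' U) ≠ ⊥ := by
    intro h
    have h1 : QuotientGroup.mk' U t ∈ K.map (QuotientGroup.mk' U) := ⟨t, htK, rfl⟩
    rw [h, Subgroup.mem_bot] at h1
    exact Set.disjoint_left.1 hU ((QuotientGroup.eq_one_iff t).1 h1) rfl
  obtain ⟨θ, ⟨n, ⟨k, hk, hkn⟩, hn⟩, hθ⟩ :=
    (Subgroup.isPGroup_quotient hUk).exists_partially_additive _ hNbot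
  refine ⟨fun t => θ (QuotientGroup.mk t), ?_, ⟨k, hk, by rwa [← hkn] at hn⟩, fun n hn q => ?_⟩
  · exact (continuous_of_discreteTopology (f := θ)).comp continuous_quotient_mk'
  · exact hθ (QuotientGroup.mk n) ⟨n, hn, rfl⟩ (QuotientGroup.mk q)

end IsProP
end Characters

/-- A bijective continuous homomorphism from a compact group to a Hausdorff group is an
isomorphism of topological groups. -/
noncomputable def ContinuousMulEquiv.ofBijectiveCompactToT2 {T P : Type*} [Group T]
    [TopologicalSpace T] [CompactSpace T] [Group P] [TopologicalSpace P] [T2Space P]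
    (π : T →ₜ* P) (hπ : Function.Bijective π) : T ≃ₜ* P where
  __ := MulEquiv.ofBijective π hπ
  continuous_toFun := π.continuous_toFun
  continuous_invFun :=
    (Continuous.homeoOfEquivCompactToT2 (f := Equiv.ofBijective π hπ) π.continuous_toFun).symm.continuous

/-! ### Splitting of 2-cocycles implies projectivity -/

section Projective

variable {p : ℕ} [Fact p.Prime] {T P : Type*} [Group T] [TopologicalSpace T]
  [Group P] [TopologicalSpace P]

/-- If the kernel is nontrivial, take `θ` additive along it and nonzero on it. Its coboundary
descends to `P` and splits there as `df`, so `θ - f ∘ π` is a character of `T` nonzero on the kernel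
of `π`. The kernel of this character is a proper closed subgroup that still maps onto `P`, against
minimality. -/
theorem SplitsTwoCocycles.injective_of_minimal [IsTopologicalGroup T] [T2Space P] (hP : SplitsTwoCocycles p P)
    (hT : IsProP p T) (π : T →ₜ* P) (hπ : Function.Surjective π)
    (hmin : ∀ S : Subgroup T, IsClosed (S : Set T) → (∀ y, ∃ s ∈ S, π s = y) → S = ⊤) :
    Function.Injective π := by
  have := hT.compactSpace
  rw [← MonoidHom.coe_coe, ← MonoidHom.ker_eq_bot_iff]
  by_contra hne
  obtain ⟨θ, hθc, ⟨n, hn, hθn⟩, hθ⟩ := hT.exists_partially_additive hne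
  let c' : T → T → ZMod p := fun x y => θ x + θ y - θ (x * y)
  have hwd : ∀ a b x y, π a = π b → π x = π y → c' a x = c' b y := by
    intro a b x y hab hxy
    have h1 : a * b⁻¹ ∈ (π : T →* P).ker := by
      simp [MonoidHom.mem_ker, hab]
    have h2 : y⁻¹ * x ∈ (π : T →* P).ker := by
      simp [MonoidHom.mem_ker, hxy]
    have e1 := (hθ _ h1 b).1
    have e2 := (hθ _ h1 (b * x)).1
    have e3 := (hθ _ h2 y).2
    have e4 := (hθ _ h2 (b * y)).2
    rw [inv_mul_cancel_right] at e1
    rw [← mul_assoc, inv_mul_cancel_right] at e2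
    rw [mul_inv_cancel_left] at e3
    rw [mul_assoc, mul_inv_cancel_left] at e4
    simp only [c']
    rw [e1, e2, e3, e4]; ring
  let s : P → T := Function.surjInv hπ
  have hs : ∀ y, π (s y) = y := Function.surjInv_eq hπ
  let c : P → P → ZMod p := fun x y => c' (s x) (s y)
  have hc : ∀ x y, c (π x) (π y) = c' x y := fun x y => hwd _ _ _ _ (hs _) (hs _)
  have hcoc : IsContTwoCocycle c := by
    constructor
    · have hq : IsQuotientMap (Prod.map π π) :=
        -- A continuous surjection from a compact space to a Hausdorff one is a quotient map, so
        -- continuity of `c` can be tested on `T × T`.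
        (π.continuous_toFun.prodMap π.continuous_toFun).isClosedMap.isQuotientMap
          (π.continuous_toFun.prodMap π.continuous_toFun) (hπ.prodMap hπ)
      rw [hq.continuous_iff]
      have : Function.uncurry c ∘ Prod.map π π = Function.uncurry c' := by
        ext ⟨x, y⟩
        exact hc x y
      rw [this]
      simp only [c', Function.uncurry_def]
      fun_prop
    · intro x y z
      obtain ⟨x, rfl⟩ := hπ x
      obtain ⟨y, rfl⟩ := hπ y
      obtain ⟨z, rfl⟩ := hπ z
      rw [← map_mul, ← map_mul, hc, hc, hc, hc]
      simp only [c', mul_assoc]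
      ring
  obtain ⟨f, hf, hcf⟩ := hP c hcoc
  have hχ : (fun t => θ t - f (π t)) ∈ contHomZMod p T := by
    refine ⟨hθc.sub (hf.comp π.continuous_toFun), fun x y => ?_⟩
    have := hcf (π x) (π y)
    rw [hc] at this
    simp only [c'] at this
    beta_reduce
    rw [map_mul]
    linear_combination -this
  have hχn : θ n - f (π n) ≠ 0 := by
    have h1 := hcf 1 1
    have h2 := hc 1 1
    have h3 := (hθ 1 (one_mem _) 1).1
    simp only [c', map_one, mul_one] at h1 h2 h3
    have h4 : π n = 1 := hn
    have h5 : f 1 = 0 := by linear_combination h2 - h1 - h3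
    rwa [h4, h5, sub_zero]
  have htop := hmin (contHomZMod.ker hχ) (contHomZMod.isClosed_ker hχ) (fun y => by
    obtain ⟨t, rfl⟩ := hπ y
    -- The exponent for which multiplying `t` by `n ^ m`, which does not change its image in `P`,
    -- brings it into the kernel of the character.
    let m : ℕ := (-(θ t - f (π t)) / (θ n - f (π n))).val
    refine ⟨t * n ^ m, ?_, ?_⟩
    · rw [contHomZMod.mem_ker, contHomZMod.apply_mul hχ, contHomZMod.apply_pow hχ,
        ZMod.natCast_zmod_val, div_mul_cancel₀ _ hχn, add_neg_cancel]
    · have h4 : π n = 1 := hn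
      rw [map_mul, map_pow, h4, one_pow, mul_one])
  exact hχn ((contHomZMod.mem_ker hχ n).1 (htop ▸ Subgroup.mem_top n))

/-- Among the closed subgroups of a compact group that surject onto a given Hausdorff quotient
there is a minimal one. -/
theorem Subgroup.exists_minimal_closed_surjective [CompactSpace T] [T1Space P] (π : T →ₜ* P)
    (hπ : Function.Surjective π) :
    ∃ S : Subgroup T, IsClosed (S : Set T) ∧ (∀ y, ∃ s ∈ S, π s = y) ∧
      ∀ S' : Subgroup T, IsClosed (S' : Set T) → (∀ y, ∃ s ∈ S', π s = y) → S' ≤ S → S' = S := by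
  let α := {S : Subgroup T // IsClosed (S : Set T) ∧ ∀ y, ∃ s ∈ S, π s = y}
  obtain ⟨m, hm⟩ := exists_maximal_of_chains_bounded (α := α) (r := fun a b => b.1 ≤ a.1)
    (fun c hc => by
      rcases c.eq_empty_or_nonempty with rfl | hne
      · exact ⟨⟨⊤, isClosed_univ, fun y => (hπ y).imp fun t ht => ⟨trivial, ht⟩⟩, by simp⟩
      have : Nonempty c := hne.to_subtype
      refine ⟨⟨⨅ a : c, a.1.1, ?_, fun y => ?_⟩, fun a ha => iInf_le (fun a : c => a.1.1) ⟨a, ha⟩⟩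
      · rw [Subgroup.coe_iInf]
        exact isClosed_iInter fun a => a.1.2.1
      · have hcl : ∀ a : c, IsClosed ((a.1.1 : Set T) ∩ π ⁻¹' {y}) := fun a =>
          a.1.2.1.inter (isClosed_singleton.preimage π.continuous_toFun)
        obtain ⟨t, ht⟩ := IsCompact.nonempty_iInter_of_directed_nonempty_isCompact_isClosed
          (fun a : c => (a.1.1 : Set T) ∩ π ⁻¹' {y})
          (fun a b => by
            rcases hc.total a.2 b.2 with h | h
            · exact ⟨b, Set.inter_subset_inter_left _ h, subset_rfl⟩
            · exact ⟨a, subset_rfl, Set.inter_subset_inter_left _ h⟩)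
          (fun a => (a.1.2.2 y).imp fun t ht => ht)
          (fun a => (hcl a).isCompact) hcl
        rw [Set.mem_iInter] at ht
        exact ⟨t, Subgroup.mem_iInf.2 fun a => (ht a).1, (ht (Classical.arbitrary c)).2⟩)
    (fun h1 h2 => h2.trans h1)
  exact ⟨m.1, m.2.1, m.2.2, fun S' h1 h2 hle => le_antisymm hle (hm ⟨S', h1, h2⟩ hle)⟩

/-- A group for which all continuous `2`-cocycles split is projective with respect to surjections
from pro-`p` groups. -/
theorem SplitsTwoCocycles.exists_section [IsTopologicalGroup T] [T2Space P] (hP : SplitsTwoCocycles p P)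
    (hT : IsProP p T) (π : T →ₜ* P) (hπ : Function.Surjective π) :
    ∃ s : P →ₜ* T, ∀ y, π (s y) = y := by
  have := hT.compactSpace
  obtain ⟨S, hSc, hS, hmin⟩ := Subgroup.exists_minimal_closed_surjective π hπ
  have : CompactSpace S := isCompact_iff_compactSpace.1 hSc.isCompact
  let i : S →ₜ* T := ⟨S.subtype, continuous_subtype_val⟩
  have hsurj : Function.Surjective (π.comp i) := fun y => by
    obtain ⟨t, ht, h⟩ := hS y
    exact ⟨⟨t, ht⟩, h⟩
  have hinj := hP.injective_of_minimal (hT.subgroup S hSc) (π.comp i) hsurj (fun S' hc h => by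
    have h1 := hmin (S'.map S.subtype) (hSc.isClosedMap_subtype_val _ hc) (fun y => by
      obtain ⟨s, hs, h⟩ := h y
      exact ⟨s, ⟨s, hs, rfl⟩, h⟩) (Subgroup.map_subtype_le S')
    rw [eq_top_iff]
    intro x _
    obtain ⟨x', hx', h2⟩ : (x : T) ∈ S'.map S.subtype := by
      rw [h1]; exact x.2
    rwa [← Subtype.ext h2])
  let e := ContinuousMulEquiv.ofBijectiveCompactToT2 (π.comp i) ⟨hinj, hsurj⟩
  exact ⟨i.comp (e.symm : P →ₜ* S), fun y => e.apply_symm_apply y⟩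

end Projective

/-! ### Dual families of characters and convergence to `1` -/

section DualFamily

variable {p : ℕ} [Fact p.Prime] {T : Type*} [Group T] [TopologicalSpace T]

/-- The attained value vectors form a subspace; a functional vanishing on it would be a linear
relation among the characters. -/
theorem contHomZMod.exists_apply_eq_of_finite {ι : Type*} [Finite ι] {b : ι → T → ZMod p}
    (hb : ∀ i, b i ∈ contHomZMod p T) (hli : LinearIndependent (ZMod p) b) (v : ι → ZMod p) :
    ∃ t, ∀ i, b i t = v i := by
  have := Fintype.ofFinite ι
  classical
  let S : Submodule (ZMod p) (ι → ZMod p) :=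
    { carrier := {v | ∃ t, ∀ i, b i t = v i}
      add_mem' := by
        rintro _ _ ⟨s, hs⟩ ⟨t, ht⟩
        exact ⟨s * t, fun i => by rw [apply_mul (hb i), hs, ht]; rfl⟩
      zero_mem' := ⟨1, fun i => apply_one (hb i)⟩
      smul_mem' := by
        rintro c _ ⟨t, ht⟩
        exact ⟨t ^ c.val, fun i => by
          rw [apply_pow (hb i), ht, ZMod.natCast_zmod_val]; rfl⟩ }
  by_contra hv
  obtain ⟨f, hfv, hfS⟩ := Submodule.exists_le_ker_of_notMem (p := S) (v := v) hv
  have hf : ∀ w : ι → ZMod p, f w = ∑ i, w i * f (Pi.single i 1) := fun w => by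
    conv_lhs => rw [pi_eq_sum_univ' w]
    simp only [map_sum, map_smul, smul_eq_mul]
  have hsum : ∑ i, f (Pi.single i 1) • b i = 0 := by
    ext t
    have h : f (fun i => b i t) = 0 := hfS ⟨t, fun _ => rfl⟩
    rw [hf] at h
    rw [Finset.sum_apply, Pi.zero_apply, ← h]
    exact Finset.sum_congr rfl fun i _ => mul_comm _ _
  have h0 := Fintype.linearIndependent_iff.1 hli _ hsum
  apply hfv
  rw [hf]
  exact Finset.sum_eq_zero fun i _ => by rw [h0 i, mul_zero]

theorem contHomZMod.exists_apply_eq [CompactSpace T] {ι : Type*} {b : ι → T → ZMod p}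
    (hb : ∀ i, b i ∈ contHomZMod p T) (hli : LinearIndependent (ZMod p) b) (v : ι → ZMod p) :
    ∃ t, ∀ i, b i t = v i := by
  obtain ⟨t, ht⟩ := CompactSpace.iInter_nonempty (t := fun i => {t | b i t = v i})
    (fun i => isClosed_singleton.preimage (hb i).1) (fun s => by
      obtain ⟨t, ht⟩ := exists_apply_eq_of_finite (fun i : s => hb i)
        (hli.comp _ Subtype.val_injective) (fun i => v i)
      exact ⟨t, Set.mem_iInter₂.2 fun i hi => ht ⟨i, hi⟩⟩)
  exact ⟨t, fun i => Set.mem_iInter.1 ht i⟩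

theorem Subgroup.exists_openSubgroup_between [IsTopologicalGroup T] [CompactSpace T]
    [TotallyDisconnectedSpace T] (N : Subgroup T) (hN : IsClosed (N : Set T)) {U : Set T}
    (hU : IsOpen U) (hNU : (N : Set T) ⊆ U) :
    ∃ V : Subgroup T, IsOpen (V : Set T) ∧ N ≤ V ∧ (V : Set T) ⊆ U := by
  obtain ⟨O, hO, hOU⟩ := compact_open_separated_mul_left hN.isCompact hU hNU
  obtain ⟨O', hO'O, hO', h1⟩ := mem_nhds_iff.1 hO
  obtain ⟨W, hW⟩ := ProfiniteGrp.exist_openNormalSubgroup_sub_open_nhds_of_one hO' h1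
  refine ⟨W.toSubgroup ⊔ N, Subgroup.isOpen_mono le_sup_left W.isOpen, le_sup_right, ?_⟩
  rw [Subgroup.normal_mul]
  exact (Set.mul_subset_mul_right (hW.trans hO'O)).trans hOU

/-- A family converging to `1` modulo a closed normal subgroup `N₀` can be modified by elements of
`N₀` so that it converges to `1`. -/
theorem exists_convergesToOne_lift [IsTopologicalGroup T] [CompactSpace T]
    [TotallyDisconnectedSpace T] {X : Type*} (N₀ : Subgroup T) [N₀.Normal]
    (hN₀ : IsClosed (N₀ : Set T)) (x : X → T)
    (hx : ∀ U : Set T, IsOpen U → (N₀ : Set T) ⊆ U → ∀ᶠ i in Filter.cofinite, x i ∈ U) :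
    ∃ y : X → T, ConvergesToOne y ∧ ∀ i, (x i)⁻¹ * y i ∈ N₀ := by
  -- Zorn's lemma is applied to pairs of a closed normal subgroup `N ≤ N₀` and a modification of `x`
  -- converging to `1` modulo `N`. A larger pair has a smaller subgroup and agrees with the old
  -- family modulo the old subgroup.
  let α := {a : Subgroup T × (X → T) // (a.1.Normal ∧ IsClosed (a.1 : Set T)) ∧
    (∀ U : Set T, IsOpen U → (a.1 : Set T) ⊆ U → ∀ᶠ i in Filter.cofinite, a.2 i ∈ U) ∧
    a.1 ≤ N₀ ∧ ∀ i, (x i)⁻¹ * a.2 i ∈ N₀}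
  let a₀ : α := ⟨(N₀, x), ⟨inferInstance, hN₀⟩, hx, le_rfl, fun i => by simp⟩
  obtain ⟨⟨⟨N, y⟩, ⟨hNn, hNc⟩, hy, hN, hxy⟩, hm⟩ := exists_maximal_of_chains_bounded (α := α)
    (r := fun a b => b.1.1 ≤ a.1.1 ∧ ∀ i, (a.1.2 i)⁻¹ * b.1.2 i ∈ a.1.1)
    (fun c hc => by
      rcases c.eq_empty_or_nonempty with rfl | hne
      · exact ⟨a₀, by simp⟩
      have : Nonempty c := hne.to_subtype
      have htot : ∀ a b : c, (b.1.1.1 ≤ a.1.1.1 ∧ ∀ i, (a.1.1.2 i)⁻¹ * b.1.1.2 i ∈ a.1.1.1) ∨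
          (a.1.1.1 ≤ b.1.1.1 ∧ ∀ i, (b.1.1.2 i)⁻¹ * a.1.1.2 i ∈ b.1.1.1) := by
        intro a b
        by_cases hab : a.1 = b.1
        · left; rw [hab]; exact ⟨le_rfl, fun i => by simp⟩
        · exact hc a.2 b.2 hab
      -- Along a chain the cosets of the `i`-th members are nested, nonempty and compact, so they
      -- have a common point.
      have hchoice : ∀ i, ∃ t, ∀ a : c, (a.1.1.2 i)⁻¹ * t ∈ a.1.1.1 := by
        intro i
        have hcl : ∀ a : c, IsClosed ((fun t => (a.1.1.2 i)⁻¹ * t) ⁻¹' (a.1.1.1 : Set T)) :=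
          fun a => a.1.2.1.2.preimage (continuous_const_mul _)
        have hsub : ∀ a b : c, b.1.1.1 ≤ a.1.1.1 → (a.1.1.2 i)⁻¹ * b.1.1.2 i ∈ a.1.1.1 →
            (fun t => (b.1.1.2 i)⁻¹ * t) ⁻¹' (b.1.1.1 : Set T) ⊆
              (fun t => (a.1.1.2 i)⁻¹ * t) ⁻¹' (a.1.1.1 : Set T) := by
          intro a b hle h t ht
          have := mul_mem h (hle ht)
          rwa [mul_assoc, mul_inv_cancel_left] at this
        obtain ⟨t, ht⟩ := IsCompact.nonempty_iInter_of_directed_nonempty_isCompact_isClosed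
          (fun a : c => (fun t => (a.1.1.2 i)⁻¹ * t) ⁻¹' (a.1.1.1 : Set T))
          (fun a b => by
            rcases htot a b with ⟨h1, h2⟩ | ⟨h1, h2⟩
            · exact ⟨b, hsub a b h1 (h2 i), subset_rfl⟩
            · exact ⟨a, subset_rfl, hsub b a h1 (h2 i)⟩)
          (fun a => ⟨a.1.1.2 i, by simp⟩) (fun a => (hcl a).isCompact) hcl
        exact ⟨t, fun a => Set.mem_iInter.1 ht a⟩
      choose z hz using hchoice
      refine ⟨⟨(⨅ a : c, a.1.1.1, z), ⟨⟨?_⟩, ?_⟩, ?_, ?_, ?_⟩, ?_⟩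
      · exact fun n hn g => Subgroup.mem_iInf.2 fun a =>
          a.1.2.1.1.conj_mem n (Subgroup.mem_iInf.1 hn a) g
      · rw [Subgroup.coe_iInf]
        exact isClosed_iInter fun a => a.1.2.1.2
      · intro U hU hsub
        rw [Subgroup.coe_iInf] at hsub
        obtain ⟨a, ha⟩ := hU.isClosed_compl.isCompact.elim_directed_family_closed
          (fun a : c => (a.1.1.1 : Set T)) (fun a => a.1.2.1.2)
          (by rwa [← Set.disjoint_iff_inter_eq_empty, Set.disjoint_compl_left_iff_subset])
          (fun a b => by
            rcases htot a b with ⟨h1, -⟩ | ⟨h1, -⟩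
            · exact ⟨b, h1, subset_rfl⟩
            · exact ⟨a, subset_rfl, h1⟩)
        rw [← Set.disjoint_iff_inter_eq_empty, Set.disjoint_compl_left_iff_subset] at ha
        obtain ⟨V, hVo, hV, hVU⟩ :=
          Subgroup.exists_openSubgroup_between a.1.1.1 a.1.2.1.2 hU ha
        filter_upwards [a.1.2.2.1 V hVo hV] with i hi
        refine hVU ?_
        have := mul_mem hi (hV (hz i a))
        rwa [mul_inv_cancel_left] at this
      · exact (iInf_le (fun a : c => a.1.1.1) (Classical.arbitrary c)).trans
          (Classical.arbitrary c).1.2.2.2.1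
      · intro i
        let a := Classical.arbitrary c
        have := mul_mem (a.1.2.2.2.2 i) (a.1.2.2.2.1 (hz i a))
        rwa [mul_assoc, mul_inv_cancel_left] at this
      · exact fun a ha => ⟨iInf_le (fun a : c => a.1.1.1) ⟨a, ha⟩, fun i => hz i ⟨a, ha⟩⟩)
    (fun {a b d} h1 h2 => ⟨h2.1.trans h1.1, fun i => by
      have := mul_mem (h1.2 i) (h1.1 (h2.2 i))
      rwa [mul_assoc, mul_inv_cancel_left] at this⟩)
  have hbot : N = ⊥ := by
    by_contra hne
    obtain ⟨n, hnN, hn⟩ := N.bot_or_exists_ne_one.resolve_left hne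
    obtain ⟨U, hU⟩ := ProfiniteGrp.exist_openNormalSubgroup_sub_open_nhds_of_one
      (isOpen_compl_singleton (x := n)) (fun h => hn h.symm)
    -- If `N ≠ ⊥`, the pair can be improved to `N ⊓ U` with `U` missing a point of `N`: all but
    -- finitely many `y i` lie in `UN`, and these are moved into `U` by elements of `N`.
    have hex : ∀ i, ∃ t, (y i)⁻¹ * t ∈ N ∧ (y i ∈ U.toSubgroup ⊔ N → t ∈ U.toSubgroup) := by
      intro i
      by_cases hi : y i ∈ U.toSubgroup ⊔ N
      · obtain ⟨u, hu, m, hm, hum⟩ := Subgroup.mem_sup_of_normal_left.1 hi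
        refine ⟨u, ?_, fun _ => hu⟩
        rw [← hum, mul_inv_rev, inv_mul_cancel_right]
        exact inv_mem hm
      · exact ⟨y i, by simp, fun h => absurd h hi⟩
    choose z hzN hzU using hex
    have hUc : IsClosed (U.toSubgroup : Set T) := Subgroup.isClosed_of_isOpen _ U.isOpen
    have h := (hm ⟨(N ⊓ U.toSubgroup, z), ⟨inferInstance, hNc.inter hUc⟩, fun W hW hsub => ?_,
      inf_le_left.trans hN, fun i => ?_⟩ ⟨inf_le_left, hzN⟩).1
    · exact hU (h hnN).2 rfl
    -- The set `U \ W` is closed and disjoint from `N`, so almost every `z i` avoids it; as almost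
    -- every `z i` lies in `U`, it lies in `W`.
    · obtain ⟨V, hVo, hV, hVW⟩ := Subgroup.exists_openSubgroup_between N hNc
        (hUc.inter hW.isClosed_compl).isOpen_compl (fun m hm hmU => hmU.2 (hsub ⟨hm, hmU.1⟩))
      filter_upwards [hy V hVo hV, hy (U.toSubgroup ⊔ N : Subgroup T)
        (Subgroup.isOpen_mono le_sup_left U.isOpen)
        (le_sup_right : N ≤ U.toSubgroup ⊔ N)] with i hi1 hi2
      have h3 := mul_mem hi1 (hV (hzN i))
      rw [mul_inv_cancel_left] at h3
      by_contra hW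
      exact hVW h3 ⟨hzU i hi2, hW⟩
    · have := mul_mem (hxy i) (hN (hzN i))
      rwa [mul_assoc, mul_inv_cancel_left] at this
  refine ⟨y, ?_, hxy⟩
  refine Filter.tendsto_iff_forall_eventually_mem.2 fun U hU => ?_
  obtain ⟨O, hOU, hO, h1⟩ := mem_nhds_iff.1 hU
  exact (hy O hO (by simpa [hbot] using h1)).mono fun i hi => hOU hi

/-- A basis of the space of continuous characters admits a dual family
converging to `1`. -/
theorem exists_dual_family [IsTopologicalGroup T] (hT : IsProP p T) {ι : Type*} [DecidableEq ι]
    (b : Module.Basis ι (ZMod p) (contHomZMod p T)) :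
    ∃ x : ι → T, ConvergesToOne x ∧ ∀ i j, (b i).1 (x j) = if i = j then 1 else 0 := by
  have := hT.compactSpace
  have := hT.totallyDisconnectedSpace
  have hli : LinearIndependent (ZMod p) (fun i => (b i : T → ZMod p)) :=
    b.linearIndependent.map' (contHomZMod p T).subtype (Submodule.ker_subtype _)
  choose x hx using fun j => contHomZMod.exists_apply_eq (fun i => (b i).2) hli
    (fun i => if i = j then 1 else 0)
  let N : Subgroup T := ⨅ i, contHomZMod.ker (b i).2
  have hNmem : ∀ t, t ∈ N ↔ ∀ i, (b i).1 t = 0 := fun t => by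
    simp only [N, Subgroup.mem_iInf, contHomZMod.mem_ker]
  have hNn : N.Normal := ⟨fun n hn g => by
    rw [hNmem] at hn ⊢
    intro i
    rw [contHomZMod.apply_mul (b i).2, contHomZMod.apply_mul (b i).2,
      contHomZMod.apply_inv (b i).2, hn i]
    ring⟩
  have hNc : IsClosed (N : Set T) := by
    rw [Subgroup.coe_iInf]
    exact isClosed_iInter fun i => contHomZMod.isClosed_ker (b i).2
  -- By compactness a neighbourhood of `N` contains the common kernel of finitely many `b i`, and `x
  -- j` lies in it for every other index `j`.
  obtain ⟨y, hy, hxy⟩ := exists_convergesToOne_lift N hNc x (fun U hU hNU => by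
    obtain ⟨s, hs⟩ := hU.isClosed_compl.isCompact.elim_finite_subfamily_closed
      (fun i => (contHomZMod.ker (b i).2 : Set T)) (fun i => contHomZMod.isClosed_ker (b i).2)
      (by
        rw [← Set.disjoint_iff_inter_eq_empty, Set.disjoint_compl_left_iff_subset,
          ← Subgroup.coe_iInf]
        exact hNU)
    rw [← Set.disjoint_iff_inter_eq_empty, Set.disjoint_compl_left_iff_subset] at hs
    filter_upwards [s.finite_toSet.compl_mem_cofinite] with j hj
    refine hs (Set.mem_iInter₂.2 fun i hi => ?_)
    change (b i).1 (x j) = 0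
    rw [hx, if_neg]
    rintro rfl
    exact hj hi)
  refine ⟨y, hy, fun i j => ?_⟩
  have h := (hNmem _).1 (hxy j) i
  rw [contHomZMod.apply_mul (b i).2, contHomZMod.apply_inv (b i).2, hx] at h
  linear_combination h

end DualFamily

/-! ### Freeness from splitting of 2-cocycles -/

section Free

variable {p : ℕ} [Fact p.Prime]

/-- Continuous homomorphisms to a Hausdorff group that agree on a set agree on the
closed subgroup it generates. -/
theorem ContinuousMonoidHom.eqOn_topologicalClosure {T H : Type*} [Group T] [TopologicalSpace T]
    [IsTopologicalGroup T] [Group H] [TopologicalSpace H] [T2Space H] {f g : T →ₜ* H} {s : Set T}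
    (h : Set.EqOn f g s) : Set.EqOn f g (Subgroup.closure s).topologicalClosure := by
  have hle : Subgroup.closure s ≤ (f : T →* H).eqLocus g := (Subgroup.closure_le _).2 h
  exact closure_minimal hle (isClosed_eq f.continuous_toFun g.continuous_toFun)

theorem SplitsTwoCocycles.isFreeProP {P : Type u} [Group P] [TopologicalSpace P]
    [IsTopologicalGroup P] (hP : IsProP p P) (hs : SplitsTwoCocycles p P) :
    IsFreeProP.{u, v} p P := by
  classical
  have := hP.compactSpace
  have := hP.t2Space
  let b := Module.Basis.ofVectorSpace (ZMod p) (contHomZMod p P)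
  obtain ⟨x, hx, hbx⟩ := exists_dual_family hP b
  have hrepr : ∀ (χ : contHomZMod p P) j, χ.1 (x j) = b.repr χ j := fun χ j => by
    conv_lhs => rw [← b.linearCombination_repr χ, Finsupp.linearCombination_apply, Finsupp.sum]
    simp only [Submodule.coe_sum, Submodule.coe_smul, Finset.sum_apply, Pi.smul_apply, hbx,
      smul_eq_mul, mul_ite, mul_one, mul_zero, Finset.sum_ite_eq', Finsupp.mem_support_iff]
    split_ifs with h
    · rfl
    · exact (not_not.1 h).symm
  -- A character killing every `x j` has zero coordinates in the basis, so no proper closed subgroup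
  -- contains the family.
  have hgen : (Subgroup.closure (Set.range x)).topologicalClosure = ⊤ := by
    by_contra hne
    obtain ⟨χ, hχ, hχ0, hχx⟩ := hP.exists_contHomZMod_ne_zero
      (Subgroup.isClosed_topologicalClosure _) hne
    refine hχ0 (congrArg Subtype.val (?_ : (⟨χ, hχ⟩ : contHomZMod p P) = 0))
    apply b.repr.injective
    ext j
    rw [← hrepr, map_zero]
    exact hχx _ (Subgroup.le_topologicalClosure _ (Subgroup.subset_closure ⟨j, rfl⟩))
  refine ⟨hP, _, x, hx, fun H _ _ _ hH f hf => ?_⟩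
  have := hH.compactSpace
  have := hH.t2Space
  have huniq : ∀ ψ ψ' : P →ₜ* H, (∀ j, ψ (x j) = f j) → (∀ j, ψ' (x j) = f j) → ψ = ψ' := by
    intro ψ ψ' h h'
    have heq : Set.EqOn ψ ψ' (Set.range x) := by
      rintro _ ⟨j, rfl⟩
      rw [h, h']
    refine DFunLike.ext _ _ fun y => ContinuousMonoidHom.eqOn_topologicalClosure heq ?_
    rw [hgen]; trivial
  let t : _ → P × H := fun j => (x j, f j)
  let T : Subgroup (P × H) := (Subgroup.closure (Set.range t)).topologicalClosure
  have hTc : IsClosed (T : Set (P × H)) := Subgroup.isClosed_topologicalClosure _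
  have hT : IsProP p T := (hP.prod hH).subgroup T hTc
  have : CompactSpace T := hT.compactSpace
  have htT : ∀ j, t j ∈ T := fun j =>
    Subgroup.le_topologicalClosure _ (Subgroup.subset_closure ⟨j, rfl⟩)
  let t' : _ → T := fun j => ⟨t j, htT j⟩
  have ht' : ConvergesToOne t' := by
    rw [ConvergesToOne, tendsto_subtype_rng]
    exact hx.prodMk_nhds hf
  let pr : T →ₜ* P := (ContinuousMonoidHom.fst P H).comp ⟨T.subtype, continuous_subtype_val⟩
  have hprt : ∀ j, pr (t' j) = x j := fun j => rfl
  have hgenT : ∀ D : Subgroup T, IsClosed (D : Set T) → (∀ j, t' j ∈ D) → D = ⊤ := by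
    intro D hD h
    have h1 : T ≤ D.map T.subtype := by
      refine Subgroup.topologicalClosure_minimal _ ((Subgroup.closure_le _).2 ?_)
        (hTc.isClosedMap_subtype_val _ hD)
      rintro _ ⟨j, rfl⟩
      exact ⟨t' j, h j, rfl⟩
    rw [eq_top_iff]
    intro y _
    obtain ⟨y', hy', h2⟩ := h1 y.2
    rwa [← Subtype.ext h2]
  -- Since `t'` tends to `1`, a character of `T` is nonzero at only finitely many `t' j`. These
  -- values are therefore coordinates of a character of `P`, and the two agree on the generators.
  have hchar : ∀ χ ∈ contHomZMod p T, ∃ η ∈ contHomZMod p P, ∀ y, χ y = η (pr y) := by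
    intro χ hχ
    have hfin : {j | χ (t' j) ≠ 0}.Finite := by
      have hmem : (contHomZMod.ker hχ : Set T) ∈ 𝓝 1 :=
        ((isOpen_discrete {0}).preimage hχ.1).mem_nhds (contHomZMod.apply_one hχ)
      exact ht' hmem
    let η : contHomZMod p P := b.repr.symm
      (Finsupp.ofSupportFinite (fun j => χ (t' j)) hfin)
    have hη : ∀ j, η.1 (x j) = χ (t' j) := fun j => by
      rw [hrepr, LinearEquiv.apply_symm_apply]; rfl
    have hdiff : χ - η.1 ∘ pr ∈ contHomZMod p T :=
      sub_mem hχ (contHomZMod.comp_mem η.2 (pr : T →* P) pr.continuous_toFun)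
    have htop := hgenT _ (contHomZMod.isClosed_ker hdiff) (fun j => by
      change χ (t' j) - η.1 (pr (t' j)) = 0
      rw [hprt, hη, sub_self])
    refine ⟨η.1, η.2, fun y => sub_eq_zero.1 ?_⟩
    exact (contHomZMod.mem_ker hdiff y).1 (htop ▸ Subgroup.mem_top y)
  have hprc : ∀ y : P, ∃ z, pr z = y := by
    have hcl : IsClosed ((pr : T →* P).range : Set P) := by
      rw [MonoidHom.coe_range]
      exact (isCompact_range pr.continuous_toFun).isClosed
    have htop : (pr : T →* P).range = ⊤ := by
      rw [eq_top_iff, ← hgen]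
      refine Subgroup.topologicalClosure_minimal _ ((Subgroup.closure_le _).2 ?_) hcl
      rintro _ ⟨j, rfl⟩
      exact ⟨t' j, rfl⟩
    exact fun y => (htop ▸ Subgroup.mem_top y : y ∈ (pr : T →* P).range)
  obtain ⟨s, hsec⟩ := hs.exists_section hT pr hprc
  -- A character vanishing on the image of `s` has the form `η ∘ pr`, and composing with `s` gives
  -- `η = 0`. So the image lies in no proper closed subgroup, and `s` is inverse to `pr`.
  have hsurj : ∀ z : T, ∃ y, s y = z := by
    have hcl : IsClosed ((s : P →* T).range : Set T) := by
      have := hT.t2Space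
      rw [MonoidHom.coe_range]
      exact (isCompact_range s.continuous_toFun).isClosed
    have htop : (s : P →* T).range = ⊤ := by
      by_contra hne
      obtain ⟨χ, hχ, hχ0, hχs⟩ := hT.exists_contHomZMod_ne_zero hcl hne
      obtain ⟨η, hη, hχη⟩ := hchar χ hχ
      refine hχ0 (funext fun z => ?_)
      have h := hχs (s (pr z)) ⟨pr z, rfl⟩
      rw [hχη, hsec] at h
      rw [hχη, h]; rfl
    exact fun z => (htop ▸ Subgroup.mem_top z : z ∈ (s : P →* T).range)
  have hst : ∀ j, s (x j) = t' j := fun j => by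
    obtain ⟨y, hy⟩ := hsurj (t' j)
    have h := hsec y
    rw [hy, hprt] at h
    rw [h, hy]
  let ψ : P →ₜ* H :=
    ((ContinuousMonoidHom.snd P H).comp ⟨T.subtype, continuous_subtype_val⟩).comp s
  have hψ : ∀ j, ψ (x j) = f j := fun j => by
    change (s (x j)).1.2 = f j
    rw [hst]
  exact ⟨ψ, hψ, fun ψ' h => huniq _ _ h hψ⟩

end Free

/-! ### The maximal pro-`p` quotient of the semidirect product -/

section Semidirect

variable {p : ℕ} {G : Type*} [Group G] {Δ : Type*} [Group Δ] {φ : Δ →* MulAut G}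

/-- The order of the image of `σ` divides both the order of `Δ` and a power of `p`, so it is `1`. -/
theorem inr_mem_of_index_eq_pow (hΔ : (Nat.card Δ).Coprime p) {U : Subgroup (G ⋊[φ] Δ)} [U.Normal]
    (hU : ∃ k : ℕ, U.index = p ^ k) (σ : Δ) : SemidirectProduct.inr σ ∈ U := by
  obtain ⟨k, hk⟩ := hU
  let q : Δ →* (G ⋊[φ] Δ) ⧸ U := (QuotientGroup.mk' U).comp SemidirectProduct.inr
  have h1 : orderOf (q σ) ∣ Nat.card Δ := (orderOf_map_dvd q σ).trans (orderOf_dvd_natCard σ)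
  have h2 : orderOf (q σ) ∣ p ^ k := hk ▸ orderOf_dvd_natCard (q σ)
  have h3 : orderOf (q σ) = 1 :=
    Nat.eq_one_of_dvd_coprimes (Nat.Coprime.pow_right k hΔ) h1 h2
  exact (QuotientGroup.eq_one_iff _).1 (orderOf_eq_one_iff.1 h3)

variable [TopologicalSpace G]

theorem inr_mem_maxProPKer [TopologicalSpace Δ] (hΔ : (Nat.card Δ).Coprime p) (σ : Δ) :
    (SemidirectProduct.inr σ : G ⋊[φ] Δ) ∈ maxProPKer p (G ⋊[φ] Δ) :=
  Subgroup.mem_sInf.2 fun _ hU => have := hU.1; inr_mem_of_index_eq_pow hΔ hU.2.2 σ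

theorem SemidirectProduct.continuous_inl [TopologicalSpace Δ] :
    Continuous (SemidirectProduct.inl : G →* G ⋊[φ] Δ) :=
  continuous_induced_rng.2 (continuous_id.prodMk continuous_const)

theorem SemidirectProduct.continuous_left [TopologicalSpace Δ] :
    Continuous (fun x : G ⋊[φ] Δ => x.left) :=
  continuous_fst.comp (continuous_induced_dom (f := SemidirectProduct.equivProd))

/-- The projection of `G ⋊ Δ` to the maximal quotient of `G` with trivial `Δ`-action. -/
def semidirectToMaxTrivialQuotient (φ : Δ →* MulAut G) : G ⋊[φ] Δ →* MaxTrivialQuotient φ :=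
  SemidirectProduct.lift (QuotientGroup.mk' _) 1 fun σ => by
    ext g
    change (QuotientGroup.mk (φ σ g) : MaxTrivialQuotient φ) = 1 * QuotientGroup.mk g * 1⁻¹
    rw [one_mul, inv_one, mul_one]
    exact (QuotientGroup.eq.2 ((maxTrivialKer_spec φ).2.2 σ g)).symm

theorem semidirectToMaxTrivialQuotient_apply (x : G ⋊[φ] Δ) :
    semidirectToMaxTrivialQuotient φ x = QuotientGroup.mk x.left := by
  change (QuotientGroup.mk x.left : MaxTrivialQuotient φ) * 1 = _
  rw [mul_one]

theorem continuous_semidirectToMaxTrivialQuotient [TopologicalSpace Δ] :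
    Continuous (semidirectToMaxTrivialQuotient φ) := by
  have : ⇑(semidirectToMaxTrivialQuotient φ) = fun x => QuotientGroup.mk x.left :=
    funext semidirectToMaxTrivialQuotient_apply
  rw [this]
  exact continuous_quotient_mk'.comp SemidirectProduct.continuous_left

variable [Fact p.Prime] [IsTopologicalGroup G] [TopologicalSpace Δ]

/-- One inclusion pulls back to `𝒢` the open normal subgroups separating points of the pro-`p` group
`G_Δ`; the other is minimality of the kernel of `G → G_Δ`. -/
theorem comap_inl_maxProPKer (hG : IsProP p G) (hΔ : (Nat.card Δ).Coprime p) :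
    (maxProPKer p (G ⋊[φ] Δ)).comap SemidirectProduct.inl = maxTrivialKer φ := by
  apply le_antisymm
  · intro g hg
    by_contra hgN
    have hQ := hG.quotient (maxTrivialKer φ) (maxTrivialKer_spec φ).2.1
    have := hQ.t2Space
    obtain ⟨U, hUn, hUo, hUk, hU⟩ := hQ.exists_openNormal_disjoint
      (isClosed_singleton (x := (QuotientGroup.mk g : MaxTrivialQuotient φ)))
      (fun h => hgN ((QuotientGroup.eq_one_iff g).1 h.symm))
    have hmem := Subgroup.mem_sInf.1 hg (U.comap (semidirectToMaxTrivialQuotient φ))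
      ⟨inferInstance, hUo.preimage continuous_semidirectToMaxTrivialQuotient,
        Subgroup.index_comap_eq_pow _ hUk⟩
    rw [Subgroup.mem_comap, semidirectToMaxTrivialQuotient_apply] at hmem
    exact Set.disjoint_left.1 hU hmem rfl
  · refine sInf_le ⟨inferInstance, ?_, fun σ g => ?_⟩
    · have : IsClosed (⋂ U ∈ {U : Subgroup (G ⋊[φ] Δ) | U.Normal ∧
          IsOpen (U : Set (G ⋊[φ] Δ)) ∧ ∃ k : ℕ, U.index = p ^ k},
          ((U.comap SemidirectProduct.inl : Subgroup G) : Set G)) :=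
        isClosed_biInter fun U hU =>
          Subgroup.isClosed_of_isOpen _ (hU.2.1.preimage SemidirectProduct.continuous_inl)
      rw [maxProPKer, Subgroup.coe_comap, Subgroup.coe_sInf, Set.preimage_iInter₂]
      exact this
    -- In `𝒢` one has `g⁻¹σ(g) = (g⁻¹σg)σ⁻¹`, and both factors die because `Δ` does.
    · rw [Subgroup.mem_comap, map_mul, map_inv, SemidirectProduct.inl_aut, ← mul_assoc, ← mul_assoc]
      refine mul_mem ?_ (inr_mem_maxProPKer hΔ σ⁻¹)
      have := Subgroup.Normal.conj_mem inferInstance _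
        (inr_mem_maxProPKer (G := G) (φ := φ) hΔ σ) (SemidirectProduct.inl g⁻¹)
      rwa [map_inv, inv_inv] at this

theorem maxProPKer_le_ker (hG : IsProP p G) (hΔ : (Nat.card Δ).Coprime p) :
    maxProPKer p (G ⋊[φ] Δ) ≤ (semidirectToMaxTrivialQuotient φ).ker := by
  intro x hx
  rw [MonoidHom.mem_ker, semidirectToMaxTrivialQuotient_apply, QuotientGroup.eq_one_iff,
    ← comap_inl_maxProPKer hG hΔ, Subgroup.mem_comap]
  rw [← SemidirectProduct.inl_left_mul_inr_right x] at hx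
  exact (Subgroup.mul_mem_cancel_right _ (inr_mem_maxProPKer hΔ _)).1 hx

theorem exists_maxTrivialQuotient_equiv_maxProPQuotient (hG : IsProP p G)
    (hΔ : (Nat.card Δ).Coprime p) :
    ∃ e : MaxTrivialQuotient φ ≃ₜ* MaxProPQuotient p (G ⋊[φ] Δ),
      ∀ g : G, e (QuotientGroup.mk g) = QuotientGroup.mk (SemidirectProduct.inl g) := by
  let F : MaxTrivialQuotient φ →* MaxProPQuotient p (G ⋊[φ] Δ) :=
    QuotientGroup.map _ _ SemidirectProduct.inl (comap_inl_maxProPKer hG hΔ).ge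
  let F' : MaxProPQuotient p (G ⋊[φ] Δ) →* MaxTrivialQuotient φ :=
    QuotientGroup.lift _ (semidirectToMaxTrivialQuotient φ) (maxProPKer_le_ker hG hΔ)
  have hF : Continuous F :=
    (continuous_quotient_mk'.comp SemidirectProduct.continuous_inl).quotient_lift _
  have hF' : Continuous F' := continuous_semidirectToMaxTrivialQuotient.quotient_lift _
  refine ⟨{ F with
    invFun := F'
    left_inv := fun x => ?_
    right_inv := fun y => ?_
    continuous_toFun := hF
    continuous_invFun := hF' }, fun g => rfl⟩
  · induction x using QuotientGroup.induction_on with | H g => ?_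
    exact semidirectToMaxTrivialQuotient_apply _
  · induction y using QuotientGroup.induction_on with | H y => ?_
    change F (semidirectToMaxTrivialQuotient φ y) = _
    rw [semidirectToMaxTrivialQuotient_apply]
    refine QuotientGroup.eq.2 ?_
    have h : y = SemidirectProduct.inl y.left * SemidirectProduct.inr y.right :=
      (SemidirectProduct.inl_left_mul_inr_right y).symm
    have h2 : (SemidirectProduct.inl y.left)⁻¹ * y = SemidirectProduct.inr y.right :=
      inv_mul_eq_iff_eq_mul.2 h
    rw [h2]
    exact inr_mem_maxProPKer hΔ _

end Semidirect

theorem proposition1p1 (p : ℕ) [Fact p.Prime]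
    {G : Type u} [Group G] [TopologicalSpace G] [IsTopologicalGroup G] (hG : IsProP p G)
    {Δ : Type w} [Group Δ] [Finite Δ] [TopologicalSpace Δ] [DiscreteTopology Δ]
    (hΔ : (Nat.card Δ).Coprime p)
    (φ : Δ →* MulAut G) (hφ : ∀ σ, Continuous (φ σ)) :
    (∃ e : MaxTrivialQuotient φ ≃ₜ* MaxProPQuotient p (G ⋊[φ] Δ),
      ∀ g : G, e (QuotientGroup.mk g) = QuotientGroup.mk (SemidirectProduct.inl g)) ∧
    ((∀ x : cohomologyZMod p 2 G, IsCohomologyInvariant p 2 φ hφ x → x = 0) →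
      IsFreeProP.{u, v} p (MaxTrivialQuotient φ)) :=
  ⟨exists_maxTrivialQuotient_equiv_maxProPQuotient hG hΔ, fun hH =>
    (splitsTwoCocycles_maxTrivialQuotient φ hΔ hφ hH).isFreeProP
      (hG.quotient _ (maxTrivialKer_spec φ).2.1)⟩
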